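/- Let $\mathcal A$ be an abelian category with enough projective objects, and let $M$ be an object of $\mathcal A$. Complexes $P_\bullet$ are indexed homologically, with differentials $P_i\to P_{i-1}$ $(i\in\mathbb Z)$, and $P_\bullet[n]$ has the term $P_{i-n}$ in degree $i$. A finite quasi-projective resolution of $M$ is a bounded complex $P_\bullet$ of projective objects for which there are integers $a_j\ge 0$ $(j\in\mathbb Z)$, not all zero, with $H_j(P_\bullet)\cong M^{a_j}$ for all $j$. If $M\neq 0$, the quasi-projective dimension $\operatorname{qpd}M\in\mathbb N\cup\{\infty\}$ is the infimum of $\sup\{i: P_i\ne 0\}-\sup\{i: H_i(P_\bullet)\neq 0\}$ over all finite quasi-projective resolutions $P_\bullet$ of $M$ (it is $\infty$ if there is none); moreover $\operatorname{qpd}0=0$. Let $\operatorname{pd}M\in\mathbb N\cup\{\infty\}$ be the projective dimension of $M$, with $\operatorname{pd}0=0$. For a deleted projective resolution $P_\bullet$ of $M$ let $\Omega^0(M)=M$ and $\Omega^i(M)=\operatorname{Im}(P_i\to P_{i-1})$ for $i\ge 1$, and let $P_i\twoheadrightarrow\Omega^i(M)$ be the canonical epimorphism (the augmentation if $i=0$).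 Then the following hold. 1. If $\operatorname{pd}M<\infty$, then $\operatorname{qpd}M=\operatorname{pd}M$. 2. If $\operatorname{qpd}M<\infty$ and $\operatorname{Ext}^k_{\mathcal A}(M,M)=0$ for all $k\ge 2$, then $\operatorname{pd}M<\infty$. 3. If $0\to N\to E\to M\to 0$ is an exact sequence in $\mathcal A$ such that $E$ is both projective and injective, then $\operatorname{qpd}M\le\operatorname{qpd}N+1$. 4. Let $P_\bullet$ be a deleted projective resolution of $M$, let $n\ge 2$ and $m\ge 0$ be integers, and let $g_\bullet:P_\bullet\to P_\bullet[n]$ be a chain map (its components in degrees below $n$ are necessarily zero). If the morphism $\Omega^{n+m}(M)\to\Omega^m(M)$ induced by $g_\bullet$, that is, the one that forms a commutative square with $g_{n+m}:P_{n+m}\to P_m$ and the canonical epimorphisms $P_{n+m}\twoheadrightarrow\Omega^{n+m}(M)$ and $P_m\twoheadrightarrow\Omega^m(M)$, is an isomorphism, then $\operatorname{qpd}M\le m$. -/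

import Mathlib

open CategoryTheory CategoryTheory.Limits

universe v u

namespace QuasiProj

attribute [local instance] Abelian.hasFiniteBiproducts

section Complexes

variable {C : Type u} [Category.{v} C] [Abelian C]

/-- The term in homological degree `i` of a complex `K`, that is, the term `K.X (-i)` in
cohomological degree `-i`. All degrees below are homological: differentials go from degree
`i + 1` to degree `i`. -/
def term (K : CochainComplex C ℤ) (i : ℤ) : C := K.X (-i)

/-- The homology object of the complex `K` in homological degree `i`. -/
noncomputable def homol (K : CochainComplex C ℤ) (i : ℤ) : C := K.homology (-i)

/-- `inf K > -∞`: the complex vanishes in all sufficiently small homological degrees. -/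
def IsBoundedBelow (K : CochainComplex C ℤ) : Prop :=
  ∃ a : ℤ, ∀ i : ℤ, i < a → IsZero (term K i)

/-- `sup K < ∞`: the complex vanishes in all sufficiently large homological degrees. -/
def IsBoundedAbove (K : CochainComplex C ℤ) : Prop :=
  ∃ b : ℤ, ∀ i : ℤ, b < i → IsZero (term K i)

/-- The supremum of the homological degrees in which the complex is nonzero. It is only used
for complexes for which this set of integers is nonempty and bounded above. -/
noncomputable def supDeg (K : CochainComplex C ℤ) : ℤ :=
  sSup {i : ℤ | ¬ IsZero (term K i)}

/-- The supremum of the homological degrees in which the homology is nonzero. It is only used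
for complexes for which this set of integers is nonempty and bounded above. -/
noncomputable def hsupDeg (K : CochainComplex C ℤ) : ℤ :=
  sSup {i : ℤ | ¬ IsZero (homol K i)}

/-- `K` is a quasi-projective resolution of `M`: a bounded below complex of projective objects
whose homology objects are finite direct sums of copies of `M`, in such a way that the numbers
of copies are not all zero. -/
structure IsQuasiProjectiveResolution (M : C) (K : CochainComplex C ℤ) : Prop where
  boundedBelow : IsBoundedBelow K
  projective : ∀ i : ℤ, Projective (term K i)
  homology_iso : ∃ a : ℤ → ℕ, (∃ j : ℤ, a j ≠ 0) ∧
    ∀ j : ℤ, Nonempty (homol K j ≅ ⨁ fun _ : Fin (a j) => M)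

/-- `K` is a finite quasi-projective resolution of `M`: a quasi-projective resolution which is
also bounded above. -/
structure IsFiniteQuasiProjectiveResolution (M : C) (K : CochainComplex C ℤ) : Prop
    extends IsQuasiProjectiveResolution M K where
  boundedAbove : IsBoundedAbove K

open Classical in
/-- The quasi-projective dimension of `M`: zero if `M` is a zero object, and otherwise the infimum
of `supDeg K - hsupDeg K` over all finite quasi-projective resolutions `K` of `M` (which is `⊤`
if there is none). For nonzero `M`, such a `K` is bounded and has nonzero homology, so both
suprema are maxima and their difference is nonnegative. -/
noncomputable def qpd (M : C) : ℕ∞ :=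
  if IsZero M then 0
  else ⨅ (K : CochainComplex C ℤ) (_ : IsFiniteQuasiProjectiveResolution M K),
    ((supDeg K - hsupDeg K).toNat : ℕ∞)

/-- The projective dimension of `M` as an element of `ℕ∞`, with value `0` at zero objects
(where Mathlib's `projectiveDimension` is `⊥`). -/
noncomputable def pd (M : C) : ℕ∞ := (projectiveDimension M).unbotD 0

end Complexes

section Syzygies

variable {C : Type u} [Category.{v} C] [Abelian C] {M : C} (P : ProjectiveResolution M)

/-- The `i`-th syzygy of `M` with respect to the projective resolution `P`: it is `M` for `i = 0`
and the image of the differential `P_i ⟶ P_{i-1}` for `i ≥ 1`. -/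
noncomputable def syzygy : ℕ → C
  | 0 => M
  | i + 1 => Limits.image (P.complex.d (i + 1) i)

/-- The canonical epimorphism from `P_i` to the `i`-th syzygy: the augmentation `P_0 ⟶ M` for
`i = 0`, and the corestriction of the differential to its image for `i ≥ 1`. -/
noncomputable def toSyzygy : (i : ℕ) → (P.complex.X i ⟶ syzygy P i)
  | 0 => P.π.f 0
  | i + 1 => factorThruImage (P.complex.d (i + 1) i)

/-- The component `P_{n+i} ⟶ P_i` of a chain map `P ⟶ P[n]`, where `P` is viewed as a complex
indexed by `ℤ` which is zero in negative homological degrees, and the term of `P[n]` in homological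
degree `j` is `P_{j-n}`. (The components in degrees smaller than `n` are zero, because `P[n]`
vanishes there.) -/
noncomputable def shiftComponent {n : ℕ} (g : P.cochainComplex ⟶ P.cochainComplex⟦(n : ℤ)⟧)
    (i : ℕ) : P.complex.X (n + i) ⟶ P.complex.X i :=
  (P.cochainComplexXIso (-((n + i : ℕ) : ℤ)) (n + i) rfl).inv ≫
    g.f (-((n + i : ℕ) : ℤ)) ≫
      (CochainComplex.shiftFunctorObjXIso P.cochainComplex (n : ℤ) (-((n + i : ℕ) : ℤ)) (-(i : ℤ))
        (by push_cast; ring)).hom ≫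
        (P.cochainComplexXIso (-(i : ℤ)) i rfl).hom

/-- The morphism `f` from the `(n+m)`-th to the `m`-th syzygy is the one induced by the chain map
`g : P ⟶ P[n]`: it makes the square with the canonical epimorphisms from `P_{n+m}` and `P_m`
commute. As these are epimorphisms, `g` determines `f`. -/
def IsInducedOnSyzygies {n : ℕ} (g : P.cochainComplex ⟶ P.cochainComplex⟦(n : ℤ)⟧) (m : ℕ)
    (f : syzygy P (n + m) ⟶ syzygy P m) : Prop :=
  toSyzygy P (n + m) ≫ f = shiftComponent P g m ≫ toSyzygy P m

end Syzygies

end QuasiProj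

/-! For a complex `K` of projectives in cohomological indexing, write `Q^i` for the opcycles, `B^i`
for the boundaries and `H^i` for the homology. Everything rests on the short exact sequences `0 →
B^i → K^i → Q^i → 0` and `0 → H^i → Q^i → B^{i+1} → 0`.

Let `K` be a finite quasi-projective resolution realising `qpd M ≤ k`, and let `t` be the top
homological degree of its homology. Above `t` the complex resolves `Q^{-t}`, so `pd Q^{-t} ≤ k`,
while `M` is a retract of `H^{-t} ⊆ Q^{-t}`. Since `K` vanishes in large cohomological degrees, a
property of the homology can be carried to all boundaries by descending induction. If `pd M` is
finite, this bounds `pd B^{-t+1}`, and comparing dimensions in the second sequence lowers the bound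
on `pd M` step by step to `k`. If the higher self-extensions vanish, it gives `Ext¹(B^{-t+1}, M) =
0`, so the retraction `H^{-t} → M` extends to `Q^{-t}` and `M` inherits finite projective dimension.

Upper bounds come from constructing complexes. Truncating a complex of projectives where its
opcycles are projective gives a finite resolution; applied to a projective resolution of `M` this
yields `qpd M ≤ pd M`. For `0 → N → E → M → 0`, injectivity of `E` gives a map from a resolution of
`N` to a complex of copies of `E` with zero differential. It is `N^a → E^a` on homology, so its cone
has homology `M^a` and is at most one step longer. For a chain map `g : P → P[n]`, the cone has
homology `M` in homological degrees `1` and `n`. Its opcycles in degree `n + m` are the pushout of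
`Ω^{n+m} → P_{n+m-1}` along the induced map `Ω^{n+m} → Ω^m`; when the latter is an isomorphism the
pushout is `P_{n+m-1}`, and truncation there is possible. -/

namespace QuasiProj

attribute [local instance] Abelian.hasFiniteBiproducts

section Dimension

variable {C : Type u} [Category.{v} C] [Abelian C]

lemma pd_le_iff (M : C) (n : ℕ) : pd M ≤ n ↔ HasProjectiveDimensionLE M n := by
  rw [← projectiveDimension_le_iff, pd]
  generalize projectiveDimension M = d
  induction d with
  | bot => simp
  | coe d => simp only [WithBot.unbotD_coe]; exact_mod_cast Iff.rfl

lemma pd_lt_top_iff (M : C) : pd M < ⊤ ↔ ∃ n : ℕ, HasProjectiveDimensionLE M n := by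
  constructor
  · intro h
    obtain ⟨n, hn⟩ := ENat.ne_top_iff_exists.1 h.ne
    exact ⟨n, (pd_le_iff M n).1 hn.ge⟩
  · rintro ⟨n, hn⟩
    exact lt_of_le_of_lt ((pd_le_iff M n).2 hn) (ENat.natCast_lt_top n)

lemma pd_of_isZero {M : C} (hM : IsZero M) : pd M = 0 := by
  rw [pd, (projectiveDimension_eq_bot_iff M).2 hM, WithBot.unbotD_bot]

lemma qpd_of_isZero {M : C} (hM : IsZero M) : qpd M = 0 := if_pos hM

end Dimension

/-! ### Boundaries, opcycles and dimension shifting -/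

section Boundaries

variable {C : Type u} [Category.{v} C] [Abelian C] (K : CochainComplex C ℤ)

/-- The subobject of boundaries in cohomological degree `i`, as the kernel of the projection to
the opcycles. -/
noncomputable abbrev boundaries (i : ℤ) : C := kernel (K.pOpcycles i)

/-- The epimorphism from the opcycles in degree `i` to the boundaries in degree `j = i + 1`. -/
noncomputable abbrev opcyclesToBoundaries (i j : ℤ) : K.opcycles i ⟶ boundaries K j :=
  kernel.lift (K.pOpcycles j) (K.fromOpcycles i j) (by
    rw [← cancel_epi (K.pOpcycles i)]; simp)

lemma boundaries_shortExact (i : ℤ) :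
    (ShortComplex.mk (kernel.ι (K.pOpcycles i)) (K.pOpcycles i)
      (kernel.condition _)).ShortExact where
  exact := ShortComplex.exact_kernel _

lemma homologyι_opcyclesToBoundaries (i j : ℤ) :
    K.homologyι i ≫ opcyclesToBoundaries K i j = 0 := by
  rw [← cancel_mono (kernel.ι _)]; simp

lemma epi_opcyclesToBoundaries {i j : ℤ} (hij : i + 1 = j) : Epi (opcyclesToBoundaries K i j) := by
  have hprev : (ComplexShape.up ℤ).prev j = i := by subst hij; simp
  have hex : (ShortComplex.mk (K.d i j) (K.pOpcycles j) (K.d_pOpcycles i j)).Exact :=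
    ShortComplex.exact_of_g_is_cokernel _ (K.opcyclesIsCokernel i j hprev)
  rw [ShortComplex.exact_iff_epi_kernel_lift] at hex
  refine epi_of_epi_fac (f := K.pOpcycles i) (h := kernel.lift (K.pOpcycles j) (K.d i j) _) ?_
  rw [← cancel_mono (kernel.ι _)]; simp

lemma homology_opcycles_shortExact {i j : ℤ} (hij : i + 1 = j) :
    (ShortComplex.mk (K.homologyι i) (opcyclesToBoundaries K i j)
      (homologyι_opcyclesToBoundaries K i j)).ShortExact where
  exact := ShortComplex.exact_of_f_is_kernel _
    (isKernelOfComp (kernel.ι (K.pOpcycles j)) (K.fromOpcycles i j)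
      (K.homologyIsKernel i j (by subst hij; simp))
      (homologyι_opcyclesToBoundaries K i j) (kernel.lift_ι _ _ _))
  epi_g := epi_opcyclesToBoundaries K hij

lemma isZero_opcycles_of_isZero {i : ℤ} (h : IsZero (K.X i)) : IsZero (K.opcycles i) :=
  IsZero.of_epi (K.pOpcycles i) h

lemma isZero_boundaries_of_isZero {i : ℤ} (h : IsZero (K.X i)) : IsZero (boundaries K i) :=
  IsZero.of_mono (kernel.ι _) h

variable {K}

/-- Where the homology vanishes, `Q^i ≅ B^{i+1}`, so each step away from the zero term `K^n` adds
one projective to a resolution of the opcycles. -/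
lemma hasProjectiveDimensionLT_opcycles {n : ℤ} (hK : ∀ i, Projective (K.X i))
    (hn : IsZero (K.X n)) (k : ℕ) (hH : ∀ i, i < n + k → IsZero (K.homology i)) :
    HasProjectiveDimensionLT (K.opcycles (n + k)) k := by
  induction k with
  | zero => simpa using (isZero_opcycles_of_isZero K hn).hasProjectiveDimensionLT_zero
  | succ k hk =>
    have hk' := hk (fun i hi => hH i (by push_cast; lia))
    have hz : IsZero (K.homology (n + k)) := hH _ (by push_cast; lia)
    have e : IsIso (opcyclesToBoundaries K (n + k) (n + (k + 1 : ℕ))) := by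
      have S := homology_opcycles_shortExact K (i := n + k) (j := n + (k + 1 : ℕ))
        (by push_cast; lia)
      exact S.isIso_g_iff.2 hz
    have := hasProjectiveDimensionLT_of_iso
      (asIso (opcyclesToBoundaries K (n + k) (n + (k + 1 : ℕ)))) k
    have hP := hK (n + (k + 1 : ℕ))
    exact (boundaries_shortExact K (n + (k + 1 : ℕ))).hasProjectiveDimensionLT_X₃ k ‹_›
      (inferInstanceAs (HasProjectiveDimensionLT (K.X (n + (k + 1 : ℕ))) (k + 1)))

/-- A predicate on the boundaries of a complex that holds in large cohomological degrees, and that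
passes from degree `i + 1` to degree `i`, holds in all degrees. -/
lemma boundaries_induction {p : C → Prop} (hp : ∀ X, IsZero X → p X)
    {b : ℤ} (hb : ∀ i, b < i → IsZero (K.X i))
    (h : ∀ i, p (boundaries K (i + 1)) → p (boundaries K i)) (i : ℤ) : p (boundaries K i) := by
  have key : ∀ (k : ℕ) (i : ℤ), b < i + k → p (boundaries K i) := by
    intro k
    induction k with
    | zero => intro i hi; exact hp _ (isZero_boundaries_of_isZero K (hb i (by simpa using hi)))
    | succ k hk => intro i hi; exact h i (hk (i + 1) (by push_cast at hi; lia))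
  exact key (b + 1 - i).toNat i (by lia)

lemma hasProjectiveDimensionLT_boundaries {b : ℤ} (hb : ∀ i, b < i → IsZero (K.X i))
    (hK : ∀ i, Projective (K.X i)) {n : ℕ}
    (hH : ∀ i, HasProjectiveDimensionLT (K.homology i) (n + 1)) (i : ℤ) :
    HasProjectiveDimensionLT (boundaries K i) (n + 1) := by
  refine boundaries_induction (p := fun X => HasProjectiveDimensionLT X (n + 1))
    (fun X hX => ?_) hb (fun i hi => ?_) i
  · have := hX.hasProjectiveDimensionLT_zero
    exact hasProjectiveDimensionLT_of_ge X 0 _ (by lia)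
  · have hQ := (homology_opcycles_shortExact K (i := i) rfl).hasProjectiveDimensionLT_X₂ (n + 1)
      (hH i) hi
    have hQ' : HasProjectiveDimensionLT (K.opcycles i) (n + 1) := hQ
    have := hK i
    exact (boundaries_shortExact K i).hasProjectiveDimensionLT_X₁ (n + 1)
      (inferInstanceAs (HasProjectiveDimensionLT (K.X i) (n + 1)))
      (hasProjectiveDimensionLT_of_ge (K.opcycles i) (n + 1) _ (by lia))

/-- Descending induction: `Ext^{k+1}(Q^i, M)` lies between the vanishing groups `Ext^{k+1}(B^{i+1},
M)` and `Ext^{k+1}(H^i, M)`, and projectivity of `K^i` shifts this to `Ext^k(B^i, M) = 0`. The shift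
is why vanishing for `k ≥ 2` on homology suffices for `k ≥ 1` on boundaries. -/
lemma ext_eq_zero_of_boundaries [HasExt.{v} C] {b : ℤ} (hb : ∀ i, b < i → IsZero (K.X i))
    (hK : ∀ i, Projective (K.X i)) {M : C}
    (hH : ∀ i k, 2 ≤ k → Subsingleton (Abelian.Ext.{v} (K.homology i) M k)) (i : ℤ) :
    ∀ k, 1 ≤ k → ∀ x : Abelian.Ext.{v} (boundaries K i) M k, x = 0 := by
  refine boundaries_induction
    (p := fun X => ∀ k, 1 ≤ k → ∀ x : Abelian.Ext.{v} X M k, x = 0)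
    (fun X hX k _ x => ?_) hb (fun i hi k hk x => ?_) i
  · have := hX.hasProjectiveDimensionLT_zero
    exact x.eq_zero_of_hasProjectiveDimensionLT 0 (by lia)
  · have hQ : ∀ y : Abelian.Ext.{v} (K.opcycles i) M (1 + k), y = 0 := by
      intro y
      obtain ⟨z, hz⟩ := Abelian.Ext.contravariant_sequence_exact₂
        (homology_opcycles_shortExact K (i := i) rfl) _ y
        (have := hH i (1 + k) (by lia); Subsingleton.elim _ _)
      rw [← hz, hi _ (by lia) z, Abelian.Ext.comp_zero]
    have := hK i
    obtain ⟨y, hy⟩ := Abelian.Ext.contravariant_sequence_exact₁ (boundaries_shortExact K i) _ x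
      (n₁ := 1 + k) rfl (hQ _)
    rw [← hy]
    have : y = 0 := by
      have : HasProjectiveDimensionLT (K.X i) 1 := inferInstance
      exact Abelian.Ext.eq_zero_of_hasProjectiveDimensionLT (X := K.X i) y 1 hk
    rw [this, Abelian.Ext.comp_zero]

end Boundaries

/-! ### Finite direct sums of copies of an object -/

section Biproducts

variable {C : Type u} [Category.{v} C] [Abelian C] (M : C)

lemma subsingleton_ext_biproduct [HasExt.{v} C] {N : C} {k : ℕ}
    (h : Subsingleton (Abelian.Ext.{v} M N k)) (a : ℕ) :
    Subsingleton (Abelian.Ext.{v} (⨁ fun _ : Fin a => M) N k) :=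
  (Abelian.Ext.biproductAddEquiv (biproduct.isBilimit fun _ : Fin a => M) N k).subsingleton

lemma hasProjectiveDimensionLT_biproduct {n : ℕ} (h : HasProjectiveDimensionLT M n) (a : ℕ) :
    HasProjectiveDimensionLT (⨁ fun _ : Fin a => M) n := by
  let := HasExt.standard C
  rw [hasProjectiveDimensionLT_iff]
  intro i hi Y e
  apply (Abelian.Ext.biproductAddEquiv (biproduct.isBilimit fun _ : Fin a => M) Y i).injective
  ext
  rw [map_zero]
  exact Abelian.Ext.eq_zero_of_hasProjectiveDimensionLT _ n hi

/-- `M` is a retract of a nonempty finite direct sum of copies of `M`. -/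
noncomputable def retractBiproduct {a : ℕ} (ha : a ≠ 0) :
    Retract M (⨁ fun _ : Fin a => M) where
  i := biproduct.ι (fun _ : Fin a => M) ⟨0, Nat.pos_of_ne_zero ha⟩
  r := biproduct.π (fun _ : Fin a => M) ⟨0, Nat.pos_of_ne_zero ha⟩

lemma isZero_biproduct_fin_zero : IsZero (⨁ fun _ : Fin 0 => M) := by
  rw [IsZero.iff_id_eq_zero]
  ext j
  exact j.elim0

/-- The direct sum of one copy of `M`. -/
noncomputable def biproductFinOneIso : (⨁ fun _ : Fin 1 => M) ≅ M :=
  biproductUniqueIso (fun _ : Fin 1 => M)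

lemma nonempty_iso_biproduct_ite {M X : C} (q : Prop) [Decidable q] (h₁ : q → Nonempty (X ≅ M))
    (h₀ : ¬ q → IsZero X) :
    Nonempty (X ≅ ⨁ fun _ : Fin (if q then 1 else 0) => M) := by
  generalize ha : (if q then 1 else 0) = a
  by_cases hq : q
  · obtain rfl : 1 = a := by simpa [hq] using ha
    exact ⟨(h₁ hq).some ≪≫ (biproductFinOneIso M).symm⟩
  · obtain rfl : 0 = a := by simpa [hq] using ha
    exact ⟨(h₀ hq).iso (isZero_biproduct_fin_zero M)⟩

end Biproducts

/-! ### Bounding the quasi-projective dimension by explicit complexes -/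

section Estimates

variable {C : Type u} [Category.{v} C] [Abelian C] {M : C} {K : CochainComplex C ℤ}

lemma homol_neg (K : CochainComplex C ℤ) (i : ℤ) : homol K (-i) = K.homology i := by
  simp only [homol, neg_neg]

lemma isZero_homol_of_isZero_term {i : ℤ} (h : IsZero (term K i)) : IsZero (homol K i) :=
  (ShortComplex.exact_iff_isZero_homology _).1 (ShortComplex.exact_of_isZero_X₂ (K.sc (-i)) h)

lemma IsQuasiProjectiveResolution.exists_bound (hK : IsQuasiProjectiveResolution M K) :
    ∃ b : ℤ, ∀ i, b < i → IsZero (K.X i) := by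
  obtain ⟨a, ha⟩ := hK.boundedBelow
  refine ⟨-a, fun i hi => ?_⟩
  have := ha (-i) (by lia)
  rwa [term, neg_neg] at this

lemma IsQuasiProjectiveResolution.projective_X (hK : IsQuasiProjectiveResolution M K) (i : ℤ) :
    Projective (K.X i) := by
  have := hK.projective (-i)
  rwa [term, neg_neg] at this

lemma IsQuasiProjectiveResolution.exists_homol_not_isZero (hM : ¬ IsZero M)
    (hK : IsQuasiProjectiveResolution M K) : ∃ j, ¬ IsZero (homol K j) := by
  obtain ⟨a, ⟨j, hj⟩, ha⟩ := hK.homology_iso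
  obtain ⟨e⟩ := ha j
  refine ⟨j, fun h => hM ?_⟩
  exact IsZero.of_mono (retractBiproduct M hj).i (h.of_iso e.symm)

lemma IsQuasiProjectiveResolution.nonempty_retract (hK : IsQuasiProjectiveResolution M K)
    {j : ℤ} (hj : ¬ IsZero (homol K j)) : Nonempty (Retract M (homol K j)) := by
  obtain ⟨a, -, ha⟩ := hK.homology_iso
  obtain ⟨e⟩ := ha j
  by_cases h0 : a j = 0
  · rw [h0] at e
    exact absurd ((isZero_biproduct_fin_zero M).of_iso e) hj
  · exact ⟨(retractBiproduct M h0).trans e.symm.retract⟩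

lemma qpd_le_iff (hM : ¬ IsZero M) (k : ℕ) : qpd M ≤ k ↔
    ∃ (K : CochainComplex C ℤ) (_ : IsFiniteQuasiProjectiveResolution M K),
      supDeg K - hsupDeg K ≤ k := by
  rw [qpd, if_neg hM]
  constructor
  · intro h
    -- The strict bound by `k + 1` is what extracts an actual resolution from the infimum.
    have h' := lt_of_le_of_lt h (show (k : ℕ∞) < ((k + 1 : ℕ) : ℕ∞) by
      exact_mod_cast Nat.lt_succ_self k)
    simp only [iInf_lt_iff] at h'
    obtain ⟨K, hK, hlt⟩ := h'
    refine ⟨K, hK, ?_⟩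
    have : (supDeg K - hsupDeg K).toNat < k + 1 := by exact_mod_cast hlt
    lia
  · rintro ⟨K, hK, hle⟩
    refine (iInf₂_le K hK).trans ?_
    have : (supDeg K - hsupDeg K).toNat ≤ k := by lia
    exact_mod_cast this

lemma exists_resolution_of_qpd_le (hM : ¬ IsZero M) {k : ℕ} (h : qpd M ≤ k) :
    ∃ (K : CochainComplex C ℤ) (_ : IsFiniteQuasiProjectiveResolution M K) (s t : ℤ),
      (∀ i, s < i → IsZero (term K i)) ∧ (∀ i, t < i → IsZero (homol K i)) ∧
      ¬ IsZero (homol K t) ∧ s ≤ t + k := by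
  obtain ⟨K, hK, hle⟩ := (qpd_le_iff hM k).1 h
  obtain ⟨b, hb⟩ := hK.boundedAbove
  have hterm : BddAbove {i : ℤ | ¬ IsZero (term K i)} :=
    ⟨b, fun i hi => le_of_not_gt fun hlt => hi (hb i hlt)⟩
  have hsub : {i : ℤ | ¬ IsZero (homol K i)} ⊆ {i : ℤ | ¬ IsZero (term K i)} :=
    fun i hi h0 => hi (isZero_homol_of_isZero_term h0)
  have hhom := hterm.mono hsub
  refine ⟨K, hK, supDeg K, hsupDeg K, fun i hi => ?_, fun i hi => ?_,
    Int.csSup_mem (hK.exists_homol_not_isZero hM) hhom, by lia⟩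
  · by_contra h0
    exact absurd (le_csSup hterm h0) (not_le.2 hi)
  · by_contra h0
    exact absurd (le_csSup hhom h0) (not_le.2 hi)

lemma qpd_le_of_resolution (hM : ¬ IsZero M) (hK : IsFiniteQuasiProjectiveResolution M K)
    {s t : ℤ} (hs : ∀ i, s < i → IsZero (term K i)) (ht : ¬ IsZero (homol K t)) {k : ℕ}
    (hk : s ≤ t + k) : qpd M ≤ k := by
  refine (qpd_le_iff hM k).2 ⟨K, hK, ?_⟩
  have h1 : s ∈ upperBounds {i : ℤ | ¬ IsZero (term K i)} :=
    fun i hi => le_of_not_gt fun hlt => hi (hs i hlt)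
  have h2 : {i : ℤ | ¬ IsZero (homol K i)} ⊆ {i : ℤ | ¬ IsZero (term K i)} :=
    fun i hi h0 => hi (isZero_homol_of_isZero_term h0)
  have h3 : supDeg K ≤ s := csSup_le ⟨t, h2 ht⟩ h1
  have h4 : t ≤ hsupDeg K := le_csSup (BddAbove.mono h2 ⟨s, h1⟩) ht
  lia

/-- The canonical truncation changes only the term in degree `n`, which becomes the opcycles, and
the terms below it, which become zero; the homology survives because it vanishes below `n`. -/
lemma isFiniteQuasiProjectiveResolution_truncGE (hK : IsQuasiProjectiveResolution M K) {n : ℤ}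
    (hH : ∀ i, i < n → IsZero (K.homology i)) (hQ : Projective (K.opcycles n)) :
    IsFiniteQuasiProjectiveResolution M (CochainComplex.truncGE K n) where
  boundedBelow := by
    obtain ⟨b, hb⟩ := hK.exists_bound
    refine ⟨min (-b) (-n), fun i hi => (hb (-i) (by lia)).of_iso ?_⟩
    exact CochainComplex.truncGEXIso K n (-i) (by lia)
  projective i := by
    dsimp only [term]
    obtain h | h | h := lt_trichotomy (-i) n
    · exact (CochainComplex.isZero_of_isStrictlyGE _ n (-i) h).projective
    · subst h
      exact Projective.of_iso (CochainComplex.truncGEXIsoOpcycles K (-i)).symm hQ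
    · exact Projective.of_iso (CochainComplex.truncGEXIso K n (-i) h).symm (hK.projective i)
  homology_iso := by
    have : K.IsGE n := (CochainComplex.isGE_iff K n).2 fun i hi =>
      (HomologicalComplex.exactAt_iff_isZero_homology _ _).2 (hH i hi)
    obtain ⟨a, ha, h⟩ := hK.homology_iso
    refine ⟨a, ha, fun j => ?_⟩
    obtain ⟨e⟩ := h j
    exact ⟨(isoOfQuasiIsoAt (CochainComplex.πTruncGE K n) (-j)).symm ≪≫ e⟩
  boundedAbove := ⟨-n, fun i hi => CochainComplex.isZero_of_isStrictlyGE _ n (-i) (by lia)⟩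

lemma qpd_le_of_projective_opcycles (hM : ¬ IsZero M) (hK : IsQuasiProjectiveResolution M K)
    {n t : ℤ} (hH : ∀ i, i < n → IsZero (K.homology i)) (hQ : Projective (K.opcycles n))
    (ht : ¬ IsZero (K.homology t)) {k : ℕ} (hk : t ≤ n + k) : qpd M ≤ k := by
  have hfin := isFiniteQuasiProjectiveResolution_truncGE hK hH hQ
  have : K.IsGE n := (CochainComplex.isGE_iff K n).2 fun i hi =>
    (HomologicalComplex.exactAt_iff_isZero_homology _ _).2 (hH i hi)
  refine qpd_le_of_resolution hM hfin (s := -n) (t := -t)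
    (fun i hi => CochainComplex.isZero_of_isStrictlyGE _ n (-i) (by lia)) (fun h0 => ht ?_)
    (by lia)
  rw [homol_neg] at h0
  exact h0.of_iso (isoOfQuasiIsoAt (CochainComplex.πTruncGE K n) t)

end Estimates

/-! ### Projective resolutions as quasi-projective resolutions -/

section ProjectiveResolution

variable {C : Type u} [Category.{v} C] [Abelian C] {M : C} (P : ProjectiveResolution M)

/-- The homology of a projective resolution of `M` in degree zero. -/
noncomputable def resolutionHomologyIso : P.cochainComplex.homology 0 ≅ M :=
  isoOfQuasiIsoAt P.π' 0 ≪≫ (HomologicalComplex.singleObjHomologySelfIso (ComplexShape.up ℤ) 0 M)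

lemma isZero_resolution_homology {i : ℤ} (hi : i ≠ 0) :
    IsZero (P.cochainComplex.homology i) :=
  (HomologicalComplex.isZero_single_obj_homology (ComplexShape.up ℤ) 0 M i hi).of_iso
    (isoOfQuasiIsoAt P.π' i)

lemma isQuasiProjectiveResolution_cochainComplex :
    IsQuasiProjectiveResolution M P.cochainComplex where
  boundedBelow := ⟨0, fun i hi => CochainComplex.isZero_of_isStrictlyLE _ 0 (-i) (by lia)⟩
  projective i := inferInstanceAs (Projective (P.cochainComplex.X (-i)))
  homology_iso := by
    refine ⟨fun j => if j = 0 then 1 else 0, ⟨0, by simp⟩, fun j => ?_⟩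
    refine nonempty_iso_biproduct_ite (j = 0) (fun hj => ?_) (fun hj => ?_)
    · subst hj
      exact ⟨resolutionHomologyIso P⟩
    · exact isZero_resolution_homology P (by lia)

/-- The opcycles in homological degree `k` are a `k`-th syzygy of `M`, so each step lowers the
dimension bound by one; for `k = n` they are projective. -/
lemma hasProjectiveDimensionLT_resolution_opcycles {n : ℕ} (hM : HasProjectiveDimensionLE M n)
    {k : ℕ} (hk : k ≤ n) :
    HasProjectiveDimensionLT (P.cochainComplex.opcycles (-(k : ℤ))) (n - k + 1) := by
  induction k with
  | zero =>
    have := HomologicalComplex.isIso_homologyι P.cochainComplex 0 1 (by simp)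
      ((CochainComplex.isZero_of_isStrictlyLE P.cochainComplex 0 1).eq_of_tgt _ _)
    simpa using hasProjectiveDimensionLT_of_iso ((resolutionHomologyIso P).symm ≪≫
      asIso (P.cochainComplex.homologyι 0)) (n + 1)
  | succ k ih =>
    have h1 := ih (by lia)
    rw [show n - k + 1 = (n - (k + 1) + 1) + 1 by lia] at h1
    have hB := (boundaries_shortExact P.cochainComplex (-(k : ℤ))).hasProjectiveDimensionLT_X₁
      (n - (k + 1) + 1)
      (inferInstanceAs (HasProjectiveDimensionLT (P.cochainComplex.X (-(k : ℤ))) _)) h1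
    have hS := homology_opcycles_shortExact P.cochainComplex
      (i := -((k + 1 : ℕ) : ℤ)) (j := -(k : ℤ)) (by push_cast; lia)
    have h0 : IsZero (P.cochainComplex.homology (-((k + 1 : ℕ) : ℤ))) :=
      isZero_resolution_homology P (by push_cast; lia)
    exact hS.hasProjectiveDimensionLT_X₂ _
      (have := h0.hasProjectiveDimensionLT_zero
       hasProjectiveDimensionLT_of_ge _ 0 _ (by lia)) hB

end ProjectiveResolution

/-! ### Finite projective dimension and vanishing self-extensions -/

section FiniteProjectiveDimension

variable {C : Type u} [Category.{v} C] [Abelian C] {M : C}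

lemma qpd_le_of_hasProjectiveDimensionLE [EnoughProjectives C] {n : ℕ}
    (h : HasProjectiveDimensionLE M n) : qpd M ≤ n := by
  by_cases hM : IsZero M
  · simp [qpd_of_isZero hM]
  let P := ProjectiveResolution.of M
  have hQ := hasProjectiveDimensionLT_resolution_opcycles P h le_rfl
  rw [Nat.sub_self, zero_add, ← projective_iff_hasProjectiveDimensionLT_one] at hQ
  exact qpd_le_of_projective_opcycles hM (isQuasiProjectiveResolution_cochainComplex P)
    (fun i hi => isZero_resolution_homology P (by lia)) hQ
    (fun h0 => hM (h0.of_iso (resolutionHomologyIso P).symm)) (t := 0) (by lia)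

lemma hasProjectiveDimensionLT_opcycles_of_resolution {K : CochainComplex C ℤ}
    (hK : IsFiniteQuasiProjectiveResolution M K) {s t : ℤ} {k : ℕ}
    (hs : ∀ i, s < i → IsZero (term K i)) (ht : ∀ i, t < i → IsZero (homol K i))
    (hk : s ≤ t + k) : HasProjectiveDimensionLE (K.opcycles (-t)) k := by
  have hX : IsZero (K.X (-(t + k + 1))) := hs (t + k + 1) (by lia)
  have := hasProjectiveDimensionLT_opcycles hK.projective_X hX (k + 1) (fun i hi => by
    have := ht (-i) (by push_cast at hi; lia)
    rwa [homol_neg] at this)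
  rwa [show -(t + k + 1) + ((k + 1 : ℕ) : ℤ) = -t by push_cast; lia] at this

/-- In `0 → H^{-t} → Q^{-t} → B^{-t+1} → 0` the middle has dimension at most `k ≤ n` and the
quotient at most `n + 1`, so `H^{-t}`, and with it its retract `M`, has dimension at most `n`. -/
lemma hasProjectiveDimensionLT_succ_of_qpd_le {n k : ℕ} (hk : k ≤ n) (hq : qpd M ≤ k)
    (h : HasProjectiveDimensionLT M (n + 2)) : HasProjectiveDimensionLT M (n + 1) := by
  by_cases hM : IsZero M
  · have := hM.hasProjectiveDimensionLT_zero
    exact hasProjectiveDimensionLT_of_ge M 0 _ (by lia)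
  obtain ⟨K, hK, s, t, hs, ht, hne, hle⟩ := exists_resolution_of_qpd_le hM hq
  obtain ⟨b, hb⟩ := hK.exists_bound
  have hH : ∀ i, HasProjectiveDimensionLT (K.homology i) (n + 1 + 1) := by
    intro i
    obtain ⟨a, -, ha⟩ := hK.homology_iso
    obtain ⟨e⟩ := ha (-i)
    rw [homol_neg] at e
    have := hasProjectiveDimensionLT_biproduct M h (a (-i))
    exact hasProjectiveDimensionLT_of_iso e.symm _
  have hB := hasProjectiveDimensionLT_boundaries hb hK.projective_X hH (-t + 1)
  have hQ := hasProjectiveDimensionLT_opcycles_of_resolution hK hs ht hle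
  have hHt := (homology_opcycles_shortExact K (i := -t) rfl).hasProjectiveDimensionLT_X₁ (n + 1)
    (hasProjectiveDimensionLT_of_ge _ (k + 1) _ (by lia)) hB
  obtain ⟨r⟩ := hK.nonempty_retract hne
  have : HasProjectiveDimensionLT (homol K t) (n + 1) := hHt
  exact r.hasProjectiveDimensionLT (n + 1)

lemma hasProjectiveDimensionLE_of_qpd_le {k : ℕ} (hq : qpd M ≤ k)
    (h : ∃ n, HasProjectiveDimensionLE M n) : HasProjectiveDimensionLE M k := by
  obtain ⟨n, hn⟩ := h
  have hd : HasProjectiveDimensionLT M (k + n + 1) :=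
    hasProjectiveDimensionLT_of_ge M (n + 1) _ (by lia)
  clear hn
  induction n with
  | zero => exact hd
  | succ n ih => exact ih (hasProjectiveDimensionLT_succ_of_qpd_le (by lia) hq hd)

theorem qpd_eq_pd_of_pd_lt_top [EnoughProjectives C] (h : pd M < ⊤) : qpd M = pd M := by
  have hex := (pd_lt_top_iff M).1 h
  apply le_antisymm
  · obtain ⟨n, hn⟩ := ENat.ne_top_iff_exists.1 h.ne
    rw [← hn]
    exact qpd_le_of_hasProjectiveDimensionLE ((pd_le_iff M n).1 hn.ge)
  · refine ENat.forall_natCast_le_iff_le.1 fun k hk => ?_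
    by_contra hlt
    rw [not_le] at hlt
    obtain ⟨q, hq⟩ := ENat.ne_top_iff_exists.1 hlt.ne_top
    have := (pd_le_iff M q).2 (hasProjectiveDimensionLE_of_qpd_le hq.ge hex)
    rw [hq] at this
    exact absurd (hk.trans this) (not_le.2 hlt)

theorem pd_lt_top_of_subsingleton_ext [HasExt.{v} C] (hq : qpd M < ⊤)
    (hE : ∀ k : ℕ, 2 ≤ k → Subsingleton (Abelian.Ext.{v} M M k)) : pd M < ⊤ := by
  by_cases hM : IsZero M
  · simp [pd_of_isZero hM]
  obtain ⟨k, hk⟩ := ENat.ne_top_iff_exists.1 hq.ne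
  obtain ⟨K, hK, s, t, hs, ht, hne, hle⟩ := exists_resolution_of_qpd_le hM hk.ge
  obtain ⟨b, hb⟩ := hK.exists_bound
  have hH : ∀ i k, 2 ≤ k → Subsingleton (Abelian.Ext.{v} (K.homology i) M k) := by
    intro i k hk
    obtain ⟨a, -, ha⟩ := hK.homology_iso
    obtain ⟨e⟩ := ha (-i)
    rw [homol_neg] at e
    have := subsingleton_ext_biproduct M (hE k hk) (a (-i))
    refine subsingleton_of_forall_eq 0 fun x => ?_
    rw [← x.mk₀_id_comp, ← e.hom_inv_id, ← Abelian.Ext.mk₀_comp_mk₀,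
      Abelian.Ext.comp_assoc_of_second_deg_zero,
      Subsingleton.elim ((Abelian.Ext.mk₀ e.inv).comp x (zero_add k)) 0, Abelian.Ext.comp_zero]
  obtain ⟨r⟩ : Nonempty (Retract M (K.homology (-t))) := hK.nonempty_retract hne
  -- The obstruction to extending `r.r` along `H^{-t} → Q^{-t}` lies in `Ext¹(B^{-t+1}, M)`, which
  -- is zero.
  obtain ⟨y, hy⟩ := Abelian.Ext.contravariant_sequence_exact₁
    (homology_opcycles_shortExact K (i := -t) rfl) M (Abelian.Ext.mk₀ r.r) (n₁ := 1) rfl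
    (ext_eq_zero_of_boundaries hb hK.projective_X hH _ 1 le_rfl _)
  obtain ⟨y, rfl⟩ := Abelian.Ext.homEquiv₀.symm.surjective y
  have hyr : K.homologyι (-t) ≫ y = r.r :=
    Abelian.Ext.homEquiv₀.symm.injective (by
      rw [Abelian.Ext.homEquiv₀_symm_apply, Abelian.Ext.mk₀_comp_mk₀] at hy
      exact hy)
  let r' : Retract M (K.opcycles (-t)) :=
    { i := r.i ≫ K.homologyι (-t)
      r := y
      retract := by rw [Category.assoc, hyr, r.retract] }
  have hQ := hasProjectiveDimensionLT_opcycles_of_resolution hK hs ht hle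
  exact (pd_lt_top_iff M).2 ⟨k, r'.hasProjectiveDimensionLT (k + 1)⟩

end FiniteProjectiveDimension

/-! ### Homology and terms of mapping cones -/

section MappingCone

variable {C : Type u} [Category.{v} C] [Abelian C]

open HomologicalComplex CochainComplex

/-- Transport of a four-term exact sequence along isomorphisms of all terms. -/
lemma exists_exact_of_iso {X₁ X₂ X₃ X₄ X₅ Y₁ Y₂ Y₃ Y₄ Y₅ : C} {f₁ : X₁ ⟶ X₂} {f₂ : X₂ ⟶ X₃}
    {f₃ : X₃ ⟶ X₄} {f₄ : X₄ ⟶ X₅} {w₁₂ : f₁ ≫ f₂ = 0} {w₂₃ : f₂ ≫ f₃ = 0} {w₃₄ : f₃ ≫ f₄ = 0}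
    (h₁₂ : (ShortComplex.mk f₁ f₂ w₁₂).Exact) (h₂₃ : (ShortComplex.mk f₂ f₃ w₂₃).Exact)
    (h₃₄ : (ShortComplex.mk f₃ f₄ w₃₄).Exact)
    (e₁ : X₁ ≅ Y₁) (e₂ : X₂ ≅ Y₂) (e₃ : X₃ ≅ Y₃) (e₄ : X₄ ≅ Y₄) (e₅ : X₅ ≅ Y₅)
    {g₁ : Y₁ ⟶ Y₂} {g₂ : Y₂ ⟶ Y₃} {g₄ : Y₄ ⟶ Y₅} (n₁ : f₁ ≫ e₂.hom = e₁.hom ≫ g₁)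
    (n₂ : f₂ ≫ e₃.hom = e₂.hom ≫ g₂) (n₄ : f₄ ≫ e₅.hom = e₄.hom ≫ g₄) :
    ∃ (δ : Y₃ ⟶ Y₄) (w₁ : g₁ ≫ g₂ = 0) (w₂ : g₂ ≫ δ = 0) (w₃ : δ ≫ g₄ = 0),
      (ShortComplex.mk _ _ w₁).Exact ∧ (ShortComplex.mk _ _ w₂).Exact ∧
        (ShortComplex.mk _ _ w₃).Exact := by
  have n₃ : f₃ ≫ e₄.hom = e₃.hom ≫ e₃.inv ≫ f₃ ≫ e₄.hom := by simp
  have w₁ : g₁ ≫ g₂ = 0 := by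
    rw [← cancel_epi e₁.hom, ← reassoc_of% n₁, ← n₂, reassoc_of% w₁₂, zero_comp, comp_zero]
  have w₂ : g₂ ≫ e₃.inv ≫ f₃ ≫ e₄.hom = 0 := by
    rw [← cancel_epi e₂.hom, ← reassoc_of% n₂, ← n₃, reassoc_of% w₂₃, zero_comp, comp_zero]
  have w₃ : (e₃.inv ≫ f₃ ≫ e₄.hom) ≫ g₄ = 0 := by
    simp [← n₄, reassoc_of% w₃₄]
  exact ⟨e₃.inv ≫ f₃ ≫ e₄.hom, w₁, w₂, w₃,
    ShortComplex.exact_of_iso (ShortComplex.isoMk e₁ e₂ e₃ n₁.symm n₂.symm) h₁₂,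
    ShortComplex.exact_of_iso (ShortComplex.isoMk e₂ e₃ e₄ n₂.symm n₃.symm) h₂₃,
    ShortComplex.exact_of_iso (ShortComplex.isoMk e₃ e₄ e₅ n₃.symm n₄.symm) h₃₄⟩

variable {F G : CochainComplex C ℤ} (φ : F ⟶ G)

/-- The long exact homology sequence of a mapping cone. -/
lemma exists_mappingCone_homology_exact (i j : ℤ) (hij : i + 1 = j) :
    ∃ (δ : (mappingCone φ).homology i ⟶ F.homology j)
      (w₂ : homologyMap φ i ≫ homologyMap (mappingCone.inr φ) i = 0)
      (w₃ : homologyMap (mappingCone.inr φ) i ≫ δ = 0)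
      (w₁ : δ ≫ homologyMap φ j = 0),
      (ShortComplex.mk _ _ w₂).Exact ∧ (ShortComplex.mk _ _ w₃).Exact ∧
        (ShortComplex.mk _ _ w₁).Exact := by
  let H := HomotopyCategory.homologyFunctor C (ComplexShape.up ℤ) 0
  have hT := HomotopyCategory.mappingCone_triangleh_distinguished φ
  let e (n : ℤ) := HomotopyCategory.homologyFunctorFactors C (ComplexShape.up ℤ) n
  exact exists_exact_of_iso (H.homologySequence_exact₂ _ hT i)
    (H.homologySequence_exact₃ _ hT i j hij) (H.homologySequence_exact₁ _ hT i j hij)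
    ((e i).app F) ((e i).app G) ((e i).app (mappingCone φ)) ((e j).app F) ((e j).app G)
    ((e i).hom.naturality φ) ((e i).hom.naturality (mappingCone.inr φ)) ((e j).hom.naturality φ)

lemma isZero_mappingCone_homology (i j : ℤ) (hij : i + 1 = j) (hG : IsZero (G.homology i))
    (hF : IsZero (F.homology j)) : IsZero ((mappingCone φ).homology i) := by
  obtain ⟨δ, w₂, w₃, w₁, h₂, h₃, h₁⟩ := exists_mappingCone_homology_exact φ i j hij
  exact h₃.isZero_X₂ (hG.eq_of_src _ _) (hF.eq_of_tgt _ _)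

lemma nonempty_mappingCone_homology_iso_left (i j : ℤ) (hij : i + 1 = j)
    (hG : IsZero (G.homology i)) (hG' : IsZero (G.homology j)) :
    Nonempty ((mappingCone φ).homology i ≅ F.homology j) := by
  obtain ⟨δ, w₂, w₃, w₁, h₂, h₃, h₁⟩ := exists_mappingCone_homology_exact φ i j hij
  have : Mono δ := h₃.mono_g (hG.eq_of_src _ _)
  have : Epi δ := h₁.epi_f (hG'.eq_of_tgt _ _)
  have : IsIso δ := isIso_of_mono_of_epi δ
  exact ⟨asIso δ⟩

lemma nonempty_mappingCone_homology_iso_right (i j : ℤ) (hij : i + 1 = j)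
    (hF : IsZero (F.homology i)) (hF' : IsZero (F.homology j)) :
    Nonempty ((mappingCone φ).homology i ≅ G.homology i) := by
  obtain ⟨δ, w₂, w₃, w₁, h₂, h₃, h₁⟩ := exists_mappingCone_homology_exact φ i j hij
  have : Mono (homologyMap (mappingCone.inr φ) i) := h₂.mono_g (hF.eq_of_src _ _)
  have : Epi (homologyMap (mappingCone.inr φ) i) := h₃.epi_f (hF'.eq_of_tgt _ _)
  have : IsIso (homologyMap (mappingCone.inr φ) i) := isIso_of_mono_of_epi _
  exact ⟨(asIso (homologyMap (mappingCone.inr φ) i)).symm⟩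

/-- If `φ` is injective on homology, then the homology of its mapping cone is the cokernel of
the map in homology. -/
lemma nonempty_mappingCone_homology_iso_cokernel (i : ℤ)
    (hφ : Mono (homologyMap φ (i + 1))) :
    Nonempty ((mappingCone φ).homology i ≅ cokernel (homologyMap φ i)) := by
  obtain ⟨δ, w₂, w₃, w₁, h₂, h₃, h₁⟩ := exists_mappingCone_homology_exact φ i (i + 1) rfl
  have hδ : δ = 0 := by rw [← cancel_mono (homologyMap φ (i + 1)), w₁, zero_comp]
  have : Epi (homologyMap (mappingCone.inr φ) i) := h₃.epi_f hδ
  exact ⟨IsColimit.coconePointUniqueUpToIso h₂.gIsCokernel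
    (colimit.isColimit _)⟩

lemma isZero_mappingCone_X (i : ℤ) (hF : IsZero (F.X (i + 1))) (hG : IsZero (G.X i)) :
    IsZero ((mappingCone φ).X i) :=
  (mappingCone.isZero_X_iff φ i).2 ⟨hF, hG⟩

lemma projective_mappingCone_X (i : ℤ) (hF : Projective (F.X (i + 1)))
    (hG : Projective (G.X i)) : Projective ((mappingCone φ).X i) :=
  Projective.of_iso (homotopyCofiber.XIsoBiprod φ i (i + 1) rfl).symm
    (inferInstanceAs (Projective (F.X (i + 1) ⊞ G.X i)))

end MappingCone

/-! ### Maps into complexes with zero differential -/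

section ZeroDifferential

variable {C : Type u} [Category.{v} C] [Abelian C]

/-- The complex with terms `X i` and zero differentials. -/
@[simps]
def zeroDifferentialComplex (X : ℤ → C) : CochainComplex C ℤ where
  X := X
  d _ _ := 0

variable {K G : CochainComplex C ℤ} (hG : ∀ i j, G.d i j = 0)

/-- A morphism from a complex to a complex with zero differentials, given by morphisms from
the opcycles. -/
@[simps]
noncomputable def homOfOpcycles (f : ∀ i, K.opcycles i ⟶ G.X i) : K ⟶ G where
  f i := K.pOpcycles i ≫ f i
  comm' i j _ := by simp [hG]

/-- The homology of a complex with zero differentials. -/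
noncomputable def homologyIsoOfZeroDifferential (i : ℤ) : G.homology i ≅ G.X i :=
  G.isoHomologyι i (i + 1) (by simp) (hG _ _) ≪≫
    (G.pOpcyclesIso (i - 1) i (by simp) (hG _ _)).symm

lemma homologyMap_homOfOpcycles (f : ∀ i, K.opcycles i ⟶ G.X i) (i : ℤ) :
    HomologicalComplex.homologyMap (homOfOpcycles hG f) i ≫
      (homologyIsoOfZeroDifferential hG i).hom = K.homologyι i ≫ f i := by
  have h : HomologicalComplex.opcyclesMap (homOfOpcycles hG f) i = f i ≫ G.pOpcycles i := by
    rw [← cancel_epi (K.pOpcycles i)]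
    simp
  simp [homologyIsoOfZeroDifferential, h]

end ZeroDifferential

/-! ### Cokernels of embeddings into projective-injective objects -/

section Frobenius

variable {C : Type u} [Category.{v} C] [Abelian C]

/-- A finite direct sum of copies of a cokernel is a cokernel. -/
noncomputable def biproductMapIsCokernel {N E M : C} {ι : N ⟶ E} {p : E ⟶ M} {w : ι ≫ p = 0}
    (h : IsColimit (CokernelCofork.ofπ p w)) (a : ℕ) :
    IsColimit (CokernelCofork.ofπ (f := biproduct.map fun _ : Fin a => ι)
      (biproduct.map fun _ : Fin a => p) (by ext; simp [w])) :=
  have : Epi p := epi_of_isColimit_cofork h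
  have hk {T : C} (k : (⨁ fun _ : Fin a => E) ⟶ T)
      (hk : (biproduct.map fun _ : Fin a => ι) ≫ k = 0) (j : Fin a) :
      ι ≫ biproduct.ι (fun _ : Fin a => E) j ≫ k = 0 := by
    simpa using biproduct.ι (fun _ : Fin a => N) j ≫= hk
  CokernelCofork.IsColimit.ofπ' _ _ fun {T} k hk' =>
    ⟨biproduct.desc fun j => (CokernelCofork.IsColimit.desc' h _ (hk k hk' j)).1, by
      ext j
      simpa using (CokernelCofork.IsColimit.desc' h _ (hk k hk' j)).2⟩

lemma projective_biproduct (E : C) [Projective E] (a : ℕ) :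
    Projective (⨁ fun _ : Fin a => E) :=
  projective_iff_hasProjectiveDimensionLT_one.2
    (hasProjectiveDimensionLT_biproduct E inferInstance a)

lemma qpd_le_qpd_add_one {M N E : C} (ι : N ⟶ E) (p : E ⟶ M) (w : ι ≫ p = 0)
    (hS : (ShortComplex.mk ι p w).ShortExact) [Projective E] [Injective E]
    [EnoughProjectives C] : qpd M ≤ qpd N + 1 := by
  by_cases hM : IsZero M
  · simp [qpd_of_isZero hM]
  by_cases hN : IsZero N
  · have : IsIso p := hS.isIso_g_iff.2 hN
    have : Projective M := Projective.of_iso (asIso p) ‹_›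
    refine (qpd_le_of_hasProjectiveDimensionLE (n := 0) ?_).trans (by simp)
    exact inferInstanceAs (HasProjectiveDimensionLT M 1)
  by_cases hq : qpd N = ⊤
  · simp [hq]
  obtain ⟨k, hk⟩ := ENat.ne_top_iff_exists.1 hq
  obtain ⟨K, hK, s, t, hs, ht, hne, hle⟩ := exists_resolution_of_qpd_le hN hk.ge
  obtain ⟨b, hb⟩ := hK.exists_bound
  obtain ⟨a, ha, haH⟩ := hK.homology_iso
  have hmono := hS.mono_f
  dsimp at hmono
  have e (i : ℤ) : K.homology i ≅ ⨁ fun _ : Fin (a (-i)) => N :=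
    eqToIso (homol_neg K i).symm ≪≫ (haH (-i)).some
  let X (i : ℤ) : C := ⨁ fun _ : Fin (a (-i)) => E
  -- Injectivity of `X i`, a sum of copies of `E`, extends `H^i ≅ N^a → E^a` to the opcycles; with
  -- zero differential in the target, no compatibility between degrees is needed.
  let f (i : ℤ) : K.opcycles i ⟶ X i :=
    Injective.factorThru ((e i).hom ≫ biproduct.map fun _ => ι) (K.homologyι i)
  have hf (i : ℤ) : K.homologyι i ≫ f i = (e i).hom ≫ biproduct.map fun _ => ι :=
    Injective.comp_factorThru _ _
  have hG : ∀ i j, (zeroDifferentialComplex X).d i j = 0 := fun _ _ => rfl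
  let φ := homOfOpcycles hG f
  have hφ (i : ℤ) : HomologicalComplex.homologyMap φ i ≫ (homologyIsoOfZeroDifferential hG i).hom =
      (e i).hom ≫ biproduct.map fun _ => ι :=
    (homologyMap_homOfOpcycles hG f i).trans (hf i)
  have hφm (i : ℤ) : Mono (HomologicalComplex.homologyMap φ i) := by
    have : Mono (HomologicalComplex.homologyMap φ i ≫
        (homologyIsoOfZeroDifferential hG i).hom) := by
      rw [hφ]
      have : Mono (biproduct.map fun _ : Fin (a (-i)) => ι) := inferInstance
      exact mono_comp (e i).hom (biproduct.map fun _ : Fin (a (-i)) => ι)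
    exact mono_of_mono _ (homologyIsoOfZeroDifferential hG i).hom
  have hcone (i : ℤ) : Nonempty ((CochainComplex.mappingCone φ).homology i ≅
      ⨁ fun _ : Fin (a (-i)) => M) := by
    obtain ⟨e'⟩ := nonempty_mappingCone_homology_iso_cokernel φ i (hφm (i + 1))
    exact ⟨e' ≪≫ cokernel.mapIso _ _ (e i) (homologyIsoOfZeroDifferential hG i) (hφ i) ≪≫
      (cokernelIsCokernel _).coconePointUniqueUpToIso
        (biproductMapIsCokernel hS.gIsCokernel (a (-i)))⟩
  have ha0 (i : ℤ) (hi : IsZero (homol K i)) : a i = 0 := by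
    by_contra h0
    exact hN (IsZero.of_mono (retractBiproduct N h0).i (hi.of_iso (haH i).some.symm))
  have hX0 (i : ℤ) (hi : IsZero (homol K (-i))) : IsZero (X i) := by
    dsimp only [X]
    rw [ha0 _ hi]
    exact isZero_biproduct_fin_zero E
  have hzero : ∀ i, s + 1 < i → IsZero (term (CochainComplex.mappingCone φ) i) := by
    intro i hi
    refine isZero_mappingCone_X φ (-i) ?_ (hX0 _ (isZero_homol_of_isZero_term (hs _ (by lia))))
    have := hs (i - 1) (by lia)
    rwa [term, neg_sub, sub_eq_neg_add] at this
  have hres : IsFiniteQuasiProjectiveResolution M (CochainComplex.mappingCone φ) :=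
    { boundedBelow := by
        refine ⟨-b, fun i hi => isZero_mappingCone_X φ (-i) (hb _ (by lia)) (hX0 _ ?_)⟩
        exact isZero_homol_of_isZero_term (hb _ (by lia))
      projective := fun i => projective_mappingCone_X φ (-i) (hK.projective_X _)
        (projective_biproduct E _)
      homology_iso := ⟨a, ha, fun j => by
        have := hcone (-j)
        rwa [neg_neg] at this⟩
      boundedAbove := ⟨s + 1, hzero⟩ }
  rw [← hk]
  refine qpd_le_of_resolution hM hres (s := s + 1) (t := t) (k := k + 1) hzero (fun h0 => ?_)
    (by push_cast; lia)
  obtain ⟨e'⟩ := hcone (-t)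
  have hat : a t ≠ 0 := fun h => hne (by
    have e := (haH t).some
    rw [h] at e
    exact (isZero_biproduct_fin_zero N).of_iso e)
  exact hM (IsZero.of_mono (retractBiproduct M (a := a (- -t)) (by simpa using hat)).i
    (h0.of_iso e'.symm))

end Frobenius

/-! ### Opcycles of a mapping cone as a pushout -/

section ConeOpcycles

open CochainComplex

variable {C : Type u} [Category.{v} C] [Abelian C] {F G : CochainComplex C ℤ} (φ : F ⟶ G)

/-- If `r : G.X p ⟶ F.X s` behaves like a lift of the differential of `F` along `φ` that is
universal among such lifts, then the opcycles of the mapping cone of `φ` in degree `p` are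
projective as soon as `F.X s` is. -/
lemma projective_mappingCone_opcycles {q p s : ℤ} (hqp : q + 1 = p) (hps : p + 1 = s)
    [Projective (F.X s)] (r : G.X p ⟶ F.X s) (hr : G.d q p ≫ r = 0)
    (hφr : φ.f p ≫ r = F.d p s)
    (huniv : ∀ {T : C} (α : F.X s ⟶ T) (β : G.X p ⟶ T), G.d q p ≫ β = 0 →
      φ.f p ≫ β = F.d p s ≫ α → r ≫ α = β) :
    Projective ((mappingCone φ).opcycles p) := by
  -- The map `(𝟙, r)` from `F.X s ⊞ G.X p` is a cokernel of the incoming cone differential; the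
  -- retraction onto the opcycles is the inclusion of the summand `F.X s`.
  let ρ : (mappingCone φ).X p ⟶ F.X s :=
    (mappingCone.fst φ).1.v p s hps + (mappingCone.snd φ).v p p (add_zero p) ≫ r
  have inlρ : (mappingCone.inl φ).v s p (by lia) ≫ ρ = 𝟙 _ := by simp [ρ]
  have inrρ : (mappingCone.inr φ).f p ≫ ρ = r := by simp [ρ]
  have inl_d : (mappingCone.inl φ).v p q (by lia) ≫ (mappingCone φ).d q p =
      φ.f p ≫ (mappingCone.inr φ).f p - F.d p s ≫ (mappingCone.inl φ).v s p (by lia) :=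
    mappingCone.inl_v_d φ p q s (by lia) (by lia)
  have inr_d : (mappingCone.inr φ).f q ≫ (mappingCone φ).d q p =
      G.d q p ≫ (mappingCone.inr φ).f p := (mappingCone.inr φ).comm q p
  have hρ : (mappingCone φ).d q p ≫ ρ = 0 := by
    refine mappingCone.ext_from φ p q (by lia) ?_ ?_
    · rw [comp_zero, reassoc_of% inl_d, Preadditive.sub_comp, Category.assoc, Category.assoc,
        inlρ, inrρ, hφr, Category.comp_id, sub_self]
    · rw [comp_zero, reassoc_of% inr_d, inrρ, hr]
  have hop : (mappingCone φ).d q p ≫ (mappingCone φ).pOpcycles p = 0 := by simp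
  have hprev : (ComplexShape.up ℤ).prev p = q := by subst hqp; simp
  let R : Retract ((mappingCone φ).opcycles p) (F.X s) :=
    { i := (mappingCone φ).descOpcycles ρ q hprev hρ
      r := (mappingCone.inl φ).v s p (by lia) ≫ (mappingCone φ).pOpcycles p
      retract := by
        rw [← cancel_epi ((mappingCone φ).pOpcycles p), HomologicalComplex.p_descOpcycles_assoc,
          Category.comp_id]
        refine mappingCone.ext_from φ s p (by lia) ?_ ?_
        · rw [reassoc_of% inlρ]
        · rw [reassoc_of% inrρ]
          -- Both conditions are the components of `d ≫ pOpcycles = 0` on the summands `G.X q` and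
          -- `F.X p`.
          refine huniv _ _ ?_ ?_
          · rw [← reassoc_of% inr_d, hop, comp_zero]
          · have := (mappingCone.inl φ).v p q (by lia) ≫= hop
            rw [comp_zero, reassoc_of% inl_d, Preadditive.sub_comp, sub_eq_zero] at this
            simpa using this }
  exact R.projective

end ConeOpcycles

/-! ### The sign in the shifted differential -/

section Shift

variable {C : Type u} [Category.{v} C] [Abelian C]

lemma exists_shift_d_comp_shiftFunctorObjXIso_hom (K : CochainComplex C ℤ) (n : ℤ)
    {i j i' j' : ℤ} (hi : i' = i + n) (hj : j' = j + n) :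
    ∃ e : (K⟦n⟧).X i ≅ K.X i',
      (K⟦n⟧).d i j ≫ (CochainComplex.shiftFunctorObjXIso K n j j' hj).hom = e.hom ≫ K.d i' j' := by
  subst hi hj
  -- The sign `(-1)^n` of the shifted differential is absorbed into the isomorphism on the source.
  refine ⟨n.negOnePow • CochainComplex.shiftFunctorObjXIso K n i _ rfl, ?_⟩
  have h : (K⟦n⟧).d i j = n.negOnePow • K.d (i + n) (j + n) := rfl
  rw [h]
  erw [Category.comp_id]
  rw [Preadditive.smul_iso_hom, Linear.units_smul_comp]
  exact congr_arg (n.negOnePow • ·) (Category.id_comp _).symm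

end Shift

/-! ### Chain maps inducing isomorphisms of syzygies -/

section Syzygies

variable {C : Type u} [Category.{v} C] [Abelian C] {M : C} (P : ProjectiveResolution M)

instance epi_toSyzygy (i : ℕ) : Epi (toSyzygy P i) := by
  cases i with
  | zero => exact inferInstanceAs (Epi (P.π.f 0))
  | succ i => exact inferInstanceAs (Epi (factorThruImage _))

lemma exists_syzygy_inclusion {i j : ℕ} (h : j + 1 = i) :
    ∃ l : syzygy P i ⟶ P.complex.X j, toSyzygy P i ≫ l = P.complex.d i j := by
  subst h
  exact ⟨image.ι _, image.fac _⟩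

lemma d_toSyzygy (i : ℕ) : P.complex.d (i + 1) i ≫ toSyzygy P i = 0 := by
  cases i with
  | zero => exact P.complex_d_comp_π_f_zero
  | succ i =>
    change P.complex.d (i + 2) (i + 1) ≫ factorThruImage (P.complex.d (i + 1) i) = 0
    rw [← cancel_mono (image.ι (P.complex.d (i + 1) i))]
    simp

lemma exact_toSyzygy (i : ℕ) : (ShortComplex.mk _ _ (d_toSyzygy P i)).Exact := by
  cases i with
  | zero => exact P.exact₀
  | succ i =>
    let α : ShortComplex.mk _ _ (d_toSyzygy P (i + 1)) ⟶
        ShortComplex.mk (P.complex.d (i + 2) (i + 1)) (P.complex.d (i + 1) i) (by simp) :=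
      { τ₁ := 𝟙 _
        τ₂ := 𝟙 _
        τ₃ := image.ι (P.complex.d (i + 1) i)
        comm₂₃ := (Category.id_comp _).trans (image.fac (P.complex.d (i + 1) i)).symm }
    have : Epi α.τ₁ := inferInstanceAs (Epi (𝟙 _))
    have : IsIso α.τ₂ := inferInstanceAs (IsIso (𝟙 _))
    have : Mono α.τ₃ := inferInstanceAs (Mono (image.ι _))
    exact (ShortComplex.exact_iff_of_epi_of_isIso_of_mono α).2 (P.exact_succ i)

lemma exists_toSyzygy_fac {i : ℕ} {T : C} (β : P.complex.X i ⟶ T)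
    (hβ : P.complex.d (i + 1) i ≫ β = 0) : ∃ c : syzygy P i ⟶ T, toSyzygy P i ≫ c = β := by
  have : Epi (ShortComplex.mk _ _ (d_toSyzygy P i)).g := epi_toSyzygy P i
  exact ⟨(exact_toSyzygy P i).desc β hβ, (exact_toSyzygy P i).g_desc β hβ⟩

variable {P} {n m : ℕ} (g : P.cochainComplex ⟶ P.cochainComplex⟦(n : ℤ)⟧)
  {f : syzygy P (n + m) ⟶ syzygy P m}

lemma projective_mappingCone_opcycles_of_isIso (hn : 2 ≤ n) (hf : IsInducedOnSyzygies P g m f)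
    [IsIso f] : Projective ((CochainComplex.mappingCone g).opcycles (-((n + m : ℕ) : ℤ))) := by
  obtain ⟨N, hN⟩ : ∃ N, N + 1 = n + m := ⟨n + m - 1, by lia⟩
  obtain ⟨l, hl⟩ := exists_syzygy_inclusion P hN
  let a := P.cochainComplexXIso (-((n + m : ℕ) : ℤ)) (n + m) rfl
  let a' := P.cochainComplexXIso (-(N : ℤ)) N rfl
  let b : (P.cochainComplex⟦(n : ℤ)⟧).X (-((n + m : ℕ) : ℤ)) ≅ P.complex.X m :=
    CochainComplex.shiftFunctorObjXIso P.cochainComplex (n : ℤ) (-((n + m : ℕ) : ℤ)) (-(m : ℤ))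
      (by push_cast; ring) ≪≫ P.cochainComplexXIso (-(m : ℤ)) m rfl
  obtain ⟨e, he⟩ := exists_shift_d_comp_shiftFunctorObjXIso_hom P.cochainComplex n
    (i := -((n + m : ℕ) : ℤ) - 1) (j := -((n + m : ℕ) : ℤ)) (i' := -((m + 1 : ℕ) : ℤ))
    (j' := -(m : ℤ)) (by push_cast; ring) (by push_cast; ring)
  let b' := e ≪≫ P.cochainComplexXIso (-((m + 1 : ℕ) : ℤ)) (m + 1) rfl
  have hd : (P.cochainComplex⟦(n : ℤ)⟧).d (-((n + m : ℕ) : ℤ) - 1) (-((n + m : ℕ) : ℤ)) ≫ b.hom =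
      b'.hom ≫ P.complex.d (m + 1) m := by
    dsimp only [b, b', Iso.trans_hom]
    rw [← Category.assoc, he,
      P.cochainComplex_d (-((m + 1 : ℕ) : ℤ)) (-(m : ℤ)) (m + 1) m rfl rfl,
      Category.assoc, Category.assoc, Category.assoc, Category.assoc, Iso.inv_hom_id,
      Category.comp_id]
  have hg : shiftComponent P g m = a.inv ≫ g.f _ ≫ b.hom := rfl
  have hF : P.cochainComplex.d (-((n + m : ℕ) : ℤ)) (-(N : ℤ)) =
      a.hom ≫ P.complex.d (n + m) N ≫ a'.inv :=
    P.cochainComplex_d _ _ (n + m) N rfl rfl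
  rw [IsInducedOnSyzygies] at hf
  have hgs : g.f (-((n + m : ℕ) : ℤ)) ≫ b.hom ≫ toSyzygy P m = a.hom ≫ toSyzygy P (n + m) ≫ f := by
    rw [hf, hg, Category.assoc, Category.assoc, Iso.hom_inv_id_assoc]
  -- The map `r` is `P_m → Ω^m ≅ Ω^{n+m} → P_{n+m-1}`, with the inverse of `f` in the middle.
  refine projective_mappingCone_opcycles g (q := -((n + m : ℕ) : ℤ) - 1) (s := -(N : ℤ))
    (by lia) (by lia) (b.hom ≫ toSyzygy P m ≫ inv f ≫ l ≫ a'.inv) ?_ ?_ ?_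
  · rw [reassoc_of% hd]
    rw [reassoc_of% (d_toSyzygy P m), zero_comp, comp_zero]
  · rw [reassoc_of% hgs, hF, IsIso.hom_inv_id_assoc, reassoc_of% hl]
  · intro T α β hβ hβα
    obtain ⟨c, hc⟩ := exists_toSyzygy_fac P (b.inv ≫ β) (by
      rw [← cancel_epi b'.hom, comp_zero]
      have h1 := hd =≫ b.inv
      rw [Category.assoc, Iso.hom_inv_id, Category.comp_id] at h1
      rwa [h1, Category.assoc, Category.assoc] at hβ)
    -- `β` kills boundaries, so it factors as `c` through `Ω^m`; then `c` and `α` agree on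
    -- `Ω^{n+m}`, as can be tested on `P_{n+m}`.
    have hfc : f ≫ c = l ≫ a'.inv ≫ α := by
      rw [← cancel_epi (toSyzygy P (n + m)), ← cancel_epi a.hom, ← reassoc_of% hgs, hc,
        Iso.hom_inv_id_assoc, hβα, hF, reassoc_of% hl, Category.assoc,
        Category.assoc]
    simp only [Category.assoc]
    rw [← hfc, IsIso.inv_hom_id_assoc, hc, Iso.hom_inv_id_assoc]

variable (P) in
lemma isZero_resolution_shift_homology {i : ℤ} (hi : (n : ℤ) + i ≠ 0) :
    IsZero ((P.cochainComplex⟦(n : ℤ)⟧).homology i) :=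
  (isZero_resolution_homology P hi).of_iso
    ((CochainComplex.ShiftSequence.shiftIso C n i _ rfl).app P.cochainComplex)

lemma isZero_mappingCone_homology_of_ne {i : ℤ} (hi₁ : i ≠ -1) (hi₂ : i ≠ -n) :
    IsZero ((CochainComplex.mappingCone g).homology i) :=
  isZero_mappingCone_homology g i (i + 1) rfl (isZero_resolution_shift_homology P (by lia))
    (isZero_resolution_homology P (by lia))

lemma nonempty_mappingCone_homology_neg_one_iso (hn : 2 ≤ n) :
    Nonempty ((CochainComplex.mappingCone g).homology (-1) ≅ M) := by
  obtain ⟨e⟩ := nonempty_mappingCone_homology_iso_left g (-1) 0 (by lia)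
    (isZero_resolution_shift_homology P (by lia)) (isZero_resolution_shift_homology P (by lia))
  exact ⟨e ≪≫ resolutionHomologyIso P⟩

lemma nonempty_mappingCone_homology_neg_iso (hn : 2 ≤ n) :
    Nonempty ((CochainComplex.mappingCone g).homology (-n) ≅ M) := by
  obtain ⟨e⟩ := nonempty_mappingCone_homology_iso_right g (-n) (-n + 1) rfl
    (isZero_resolution_homology P (by lia)) (isZero_resolution_homology P (by lia))
  exact ⟨e ≪≫ (CochainComplex.ShiftSequence.shiftIso C n (-n) 0 (by lia)).app P.cochainComplex ≪≫
    resolutionHomologyIso P⟩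

/-- The cone places the homology of `P` in homological degree `1` and that of `P[n]` in degree `n`.
As `n ≥ 2` these degrees differ, so no nontrivial extension of `M` by `M` can occur. -/
lemma isQuasiProjectiveResolution_mappingCone (hn : 2 ≤ n) :
    IsQuasiProjectiveResolution M (CochainComplex.mappingCone g) where
  boundedBelow := ⟨0, fun i hi => isZero_mappingCone_X g (-i)
    (CochainComplex.isZero_of_isStrictlyLE _ 0 _ (by lia))
    (CochainComplex.isZero_of_isStrictlyLE P.cochainComplex 0 (-i + n) (by lia))⟩
  projective i := projective_mappingCone_X g (-i) inferInstance
    (inferInstanceAs (Projective (P.cochainComplex.X (-i + n))))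
  homology_iso := by
    refine ⟨fun j => if j = 1 ∨ j = n then 1 else 0, ⟨1, by simp⟩, fun j => ?_⟩
    refine nonempty_iso_biproduct_ite (j = 1 ∨ j = n) ?_ (fun hj => ?_)
    · rintro (rfl | rfl)
      · exact nonempty_mappingCone_homology_neg_one_iso g hn
      · exact nonempty_mappingCone_homology_neg_iso g hn
    · rw [not_or] at hj
      exact isZero_mappingCone_homology_of_ne g (by lia) (by lia)

theorem qpd_le_of_isIso_syzygy_map (hn : 2 ≤ n) (hf : IsInducedOnSyzygies P g m f)
    [IsIso f] : qpd M ≤ m := by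
  by_cases hM : IsZero M
  · simp [qpd_of_isZero hM]
  -- Truncation leaves no term above homological degree `n + m`, and the homology in degree `n` is
  -- nonzero: the difference is `m`.
  refine qpd_le_of_projective_opcycles hM (isQuasiProjectiveResolution_mappingCone g hn)
    (n := -((n + m : ℕ) : ℤ)) (t := -n)
    (fun i hi => isZero_mappingCone_homology_of_ne g (by lia) (by lia))
    (projective_mappingCone_opcycles_of_isIso g hn hf) (fun h0 => hM ?_) (by push_cast; lia)
  exact h0.of_iso (nonempty_mappingCone_homology_neg_iso g hn).some.symm

end Syzygies

end QuasiProj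

theorem theorem1p2 {C : Type u} [Category.{v} C] [Abelian C] [EnoughProjectives C] (M : C) :
    (QuasiProj.pd M < ⊤ → QuasiProj.qpd M = QuasiProj.pd M) ∧
    (QuasiProj.qpd M < ⊤ →
      (∀ k : ℕ, 2 ≤ k →
        haveI : HasExt.{v} C := hasExt_of_enoughProjectives.{v} C
        Subsingleton (Abelian.Ext.{v} M M k)) →
      QuasiProj.pd M < ⊤) ∧
    (∀ (N E : C) (ι : N ⟶ E) (p : E ⟶ M) (w : ι ≫ p = 0),
      (ShortComplex.mk ι p w).ShortExact → Projective E → Injective E →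
      QuasiProj.qpd M ≤ QuasiProj.qpd N + 1) ∧
    (∀ (P : ProjectiveResolution M) (n m : ℕ), 2 ≤ n →
      ∀ (g : P.cochainComplex ⟶ P.cochainComplex⟦(n : ℤ)⟧)
        (f : QuasiProj.syzygy P (n + m) ⟶ QuasiProj.syzygy P m),
        QuasiProj.IsInducedOnSyzygies P g m f → IsIso f →
        QuasiProj.qpd M ≤ m) := by
  have : HasExt.{v} C := hasExt_of_enoughProjectives.{v} C
  exact ⟨QuasiProj.qpd_eq_pd_of_pd_lt_top, QuasiProj.pd_lt_top_of_subsingleton_ext,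
    fun N E ι p w hS _ _ => QuasiProj.qpd_le_qpd_add_one ι p w hS,
    fun P n m hn g f hf _ => QuasiProj.qpd_le_of_isIso_syzygy_map g hn hf⟩
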